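/- Let $K$ be an algebraically closed field of characteristic zero. All superalgebras are finite-dimensional, associative (not assumed unital) and $\mathbb Z_2$-graded over $K$: $A=A_{\bar 0}\oplus A_{\bar 1}$ with $A_\alpha A_\beta\subseteq A_{\alpha+\beta}$. Isomorphisms preserve the product and the grading. $A$ is simple if $A\cdot A\neq 0$ and its only graded two-sided ideals are $0$ and $A$. An odd-symmetric structure on $A$ is a bilinear form $B:A\times A\to K$ that is odd ($B(A_{\bar 0},A_{\bar 0})=B(A_{\bar 1},A_{\bar 1})=0$), supersymmetric ($B(x,y)=(-1)^{|x||y|}B(y,x)$ for homogeneous $x,y$), associative ($B(xy,z)=B(x,yz)$) and non-degenerate. For $r\ge 1$, $s\ge 0$ let $M_{r,s}(K)$ be the algebra of $(r+s)\times(r+s)$ matrices, with even part the block diagonal matrices $\begin{pmatrix}a&0\\0&b\end{pmatrix}$ and odd part the matrices $\begin{pmatrix}0&c\\d&0\end{pmatrix}$. For $n\ge1$ let $Q_n(K)\subseteq M_{n,n}(K)$ be the sub-superalgebra of all $\tilde a+\bar b$ with $a,b\in M_n(K)$, where $\tilde a=\begin{pmatrix}a&0\\0&a\end{pmatrix}$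 is even and $\bar b=\begin{pmatrix}0&b\\b&0\end{pmatrix}$ is odd. 1. For every $n\ge 1$, $Q_n(K)$ is simple, and the bilinear form $B$ with $B(\tilde a,\bar b)=B(\bar b,\tilde a)=\operatorname{tr}(ab)$ and $B(\tilde a,\tilde a')=B(\bar b,\bar b')=0$ is an odd-symmetric structure on it. Every odd-symmetric structure on $Q_n(K)$ is a nonzero scalar multiple of this $B$. 2. For all $r\ge1$, $s\ge0$, $M_{r,s}(K)$ is simple and admits no odd-symmetric structure. 3. A simple associative superalgebra $A$ admits an odd-symmetric structure if and only if $A\cong Q_n(K)$ for some $n\ge 1$. 4. Up to isomorphism, $Q_1(K)$ is the unique simple associative superalgebra that admits an odd-symmetric structure and is commutative as an ordinary algebra: a simple $A$ admits an odd-symmetric structure and satisfies $xy=yx$ for all $x,y\in A$ if and only if $A\cong Q_1(K)$. (In the sense of the sign rule $xy=(-1)^{|x||y|}yx$ for homogeneous $x,y$, no simple associative superalgebra that admits an odd-symmetric structure is supercommutative.) -/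

import Mathlib

namespace Superalg

section General

variable {K A : Type*} [Field K] [NonUnitalRing A] [Module K A]

/-- The family indexed by `ZMod 2` with even part `E` and odd part `O`. -/
def grading (E O : Submodule K A) : ZMod 2 → Submodule K A :=
  fun i => if i = 0 then E else O

/-- `𝒜` makes the associative (not necessarily unital) `K`-algebra `A` an associative
superalgebra: `A` is the direct sum of `𝒜 0` and `𝒜 1`, and `𝒜 i * 𝒜 j ⊆ 𝒜 (i + j)`. -/
structure IsSuperalgebra (𝒜 : ZMod 2 → Submodule K A) : Prop where
  isCompl : IsCompl (𝒜 0) (𝒜 1)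
  mul_mem : ∀ (i j : ZMod 2) (x y : A), x ∈ 𝒜 i → y ∈ 𝒜 j → x * y ∈ 𝒜 (i + j)

/-- Graded two-sided ideals: two-sided ideals `I` with `I = (I ∩ 𝒜 0) ⊕ (I ∩ 𝒜 1)`. -/
structure IsGradedIdeal (𝒜 : ZMod 2 → Submodule K A) (I : Submodule K A) : Prop where
  mul_left_mem : ∀ a x : A, x ∈ I → a * x ∈ I
  mul_right_mem : ∀ a x : A, x ∈ I → x * a ∈ I
  graded : I = (I ⊓ 𝒜 0) ⊔ (I ⊓ 𝒜 1)

/-- Simple superalgebras: the product is not null and the only graded two-sided ideals are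
`0` and `A`. -/
structure IsSimpleSuperalgebra (𝒜 : ZMod 2 → Submodule K A) : Prop where
  superalgebra : IsSuperalgebra 𝒜
  exists_mul_ne_zero : ∃ x y : A, x * y ≠ 0
  eq_bot_or_eq_top : ∀ I : Submodule K A, IsGradedIdeal 𝒜 I → I = ⊥ ∨ I = ⊤

/-- `B` is homogeneous of degree `γ`: `B(A_α, A_β) ⊆ K_{α+β+γ}` where `K` is purely even. -/
def IsHomogeneousForm (𝒜 : ZMod 2 → Submodule K A) (γ : ZMod 2)
    (B : LinearMap.BilinForm K A) : Prop :=
  ∀ (i j : ZMod 2) (x y : A), x ∈ 𝒜 i → y ∈ 𝒜 j → i + j + γ ≠ 0 → B x y = 0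

/-- `B` is an odd-symmetric structure: an odd, supersymmetric, associative, non-degenerate
bilinear form. -/
structure IsOddSymmetric (𝒜 : ZMod 2 → Submodule K A)
    (B : LinearMap.BilinForm K A) : Prop where
  odd : IsHomogeneousForm 𝒜 1 B
  supersymmetric : ∀ (i j : ZMod 2) (x y : A), x ∈ 𝒜 i → y ∈ 𝒜 j →
    B x y = (-1) ^ (i.val * j.val) * B y x
  assoc : ∀ x y z : A, B (x * y) z = B x (y * z)
  nondegenerate : ∀ x : A, (∀ y : A, B x y = 0) → x = 0

/-- Supercommutativity, in the sense of the sign rule. -/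
def IsSupercommutative (𝒜 : ZMod 2 → Submodule K A) : Prop :=
  ∀ (i j : ZMod 2) (x y : A), x ∈ 𝒜 i → y ∈ 𝒜 j →
    x * y = ((-1 : K) ^ (i.val * j.val)) • (y * x)

/-- Isomorphism of superalgebras: a bijective linear map that preserves products and parity. -/
def Isomorphic {A' : Type*} [NonUnitalRing A'] [Module K A']
    (𝒜 : ZMod 2 → Submodule K A) (𝒜' : ZMod 2 → Submodule K A') : Prop :=
  ∃ e : A ≃ₗ[K] A', (∀ x y : A, e (x * y) = e x * e y) ∧
    ∀ (i : ZMod 2) (x : A), x ∈ 𝒜 i ↔ e x ∈ 𝒜' i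

end General

section Examples

variable (K : Type*) [Field K]

/-- The underlying algebra of `M_{r,s}(K)`, written in blocks. -/
abbrev Mat (r s : ℕ) : Type _ := Matrix (Fin r ⊕ Fin s) (Fin r ⊕ Fin s) K

/-- The block diagonal matrices. -/
def matEven (r s : ℕ) : Submodule K (Mat K r s) where
  carrier := {x | ∃ a b, x = Matrix.fromBlocks a 0 0 b}
  zero_mem' := ⟨0, 0, by simp⟩
  add_mem' := by
    rintro _ _ ⟨a, b, rfl⟩ ⟨a', b', rfl⟩
    exact ⟨a + a', b + b', by simp [Matrix.fromBlocks_add]⟩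
  smul_mem' := by
    rintro c _ ⟨a, b, rfl⟩
    exact ⟨c • a, c • b, by simp [Matrix.fromBlocks_smul]⟩

/-- The block antidiagonal matrices. -/
def matOdd (r s : ℕ) : Submodule K (Mat K r s) where
  carrier := {x | ∃ c d, x = Matrix.fromBlocks 0 c d 0}
  zero_mem' := ⟨0, 0, by simp⟩
  add_mem' := by
    rintro _ _ ⟨a, b, rfl⟩ ⟨a', b', rfl⟩
    exact ⟨a + a', b + b', by simp [Matrix.fromBlocks_add]⟩
  smul_mem' := by
    rintro c _ ⟨a, b, rfl⟩
    exact ⟨c • a, c • b, by simp [Matrix.fromBlocks_smul]⟩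

/-- The grading of `M_{r,s}(K)`. -/
def matGrading (r s : ℕ) : ZMod 2 → Submodule K (Mat K r s) :=
  grading (matEven K r s) (matOdd K r s)

/-- The algebra `Q_n(K)` of block matrices with rows `(a, b)`, `(b, a)`. -/
def Queer (n : ℕ) : Subalgebra K (Mat K n n) where
  carrier := {x | ∃ a b, x = Matrix.fromBlocks a b b a}
  mul_mem' := by
    rintro _ _ ⟨a, b, rfl⟩ ⟨a', b', rfl⟩
    exact ⟨a * a' + b * b', a * b' + b * a', by
      simp [Matrix.fromBlocks_multiply, add_comm]⟩
  add_mem' := by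
    rintro _ _ ⟨a, b, rfl⟩ ⟨a', b', rfl⟩
    exact ⟨a + a', b + b', by simp [Matrix.fromBlocks_add]⟩
  algebraMap_mem' := fun c => ⟨algebraMap K _ c, 0, by
    simp [Matrix.algebraMap_eq_diagonal, Matrix.fromBlocks_diagonal]⟩

variable {K} in
/-- The even element `ã` of `Q_n(K)`. -/
def queerEven {n : ℕ} (a : Matrix (Fin n) (Fin n) K) : Queer K n :=
  ⟨Matrix.fromBlocks a 0 0 a, a, 0, rfl⟩

variable {K} in
/-- The odd element `b̄` of `Q_n(K)`. -/
def queerOdd {n : ℕ} (b : Matrix (Fin n) (Fin n) K) : Queer K n :=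
  ⟨Matrix.fromBlocks 0 b b 0, 0, b, rfl⟩

/-- The grading of `Q_n(K)` inherited from `M_{n,n}(K)`. -/
def queerGrading (n : ℕ) : ZMod 2 → Submodule K (Queer K n) :=
  fun i => (matGrading K n n i).comap (Queer K n).val.toLinearMap

/-- The bilinear form on `Q_n(K)` given by
`(ã + b̄, ã' + b̄') ↦ tr (a * b') + tr (b * a')`. -/
def queerForm (n : ℕ) : LinearMap.BilinForm K (Queer K n) :=
  LinearMap.mk₂ K
    (fun x y => (x.1.toBlocks₁₁ * y.1.toBlocks₁₂).trace +
      (x.1.toBlocks₁₂ * y.1.toBlocks₁₁).trace)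
    (by
      intro x x' y
      have h₁ : (x + x').1.toBlocks₁₁ = x.1.toBlocks₁₁ + x'.1.toBlocks₁₁ := rfl
      have h₂ : (x + x').1.toBlocks₁₂ = x.1.toBlocks₁₂ + x'.1.toBlocks₁₂ := rfl
      simp only [h₁, h₂, add_mul, Matrix.trace_add]
      ring)
    (by
      intro c x y
      have h₁ : (c • x).1.toBlocks₁₁ = c • x.1.toBlocks₁₁ := rfl
      have h₂ : (c • x).1.toBlocks₁₂ = c • x.1.toBlocks₁₂ := rfl
      simp only [h₁, h₂, Matrix.smul_mul, Matrix.trace_smul, smul_add])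
    (by
      intro x y y'
      have h₁ : (y + y').1.toBlocks₁₁ = y.1.toBlocks₁₁ + y'.1.toBlocks₁₁ := rfl
      have h₂ : (y + y').1.toBlocks₁₂ = y.1.toBlocks₁₂ + y'.1.toBlocks₁₂ := rfl
      simp only [h₁, h₂, mul_add, Matrix.trace_add]
      ring)
    (by
      intro c x y
      have h₁ : (c • y).1.toBlocks₁₁ = c • y.1.toBlocks₁₁ := rfl
      have h₂ : (c • y).1.toBlocks₁₂ = c • y.1.toBlocks₁₂ := rfl
      simp only [h₁, h₂, Matrix.mul_smul, Matrix.trace_smul, smul_add])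

end Examples

end Superalg

/-! Everything turns on whether a simple superalgebra `A` stays simple when the grading is
forgotten.

If it does, it is a full matrix algebra (`exists_matrix_equiv_of_simple`). An odd supersymmetric
form is symmetric in the plain sense, so `B(1, ·)` is a multiple `c · tr` of the trace
(`exists_eq_smul_trace`). The unit is even, so `B(1, 1) = 0`; in characteristic zero `tr 1 ≠ 0`,
hence `c = 0`, against non-degeneracy. This also excludes `M_{r,s}`.

If it does not, take a proper nonzero ideal `I` and let `σ` be the parity automorphism. Both `I ∩
σI` and `I + σI` are graded ideals, so `A = I ⊕ σI` (`isCompl_map_parity`), where `I` is a simple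
algebra, hence some `M_n(K)`. Thus `A` is `M_n × M_n` with parity swapping the factors, which is
`Q_n` (`isomorphic_queer`). -/

namespace Superalg

/-! ### Wedderburn's theorem without assuming a unit. -/

section SimpleAlgebra

variable {K S : Type*} [Field K] [NonUnitalRing S] [Module K S]
  [IsScalarTower K S S] [SMulCommClass K S S]

/-- Two-sided ideals of a not necessarily unital algebra, as linear subspaces. -/
def IsTwoSidedIdeal (I : Submodule K S) : Prop :=
  ∀ a x : S, x ∈ I → a * x ∈ I ∧ x * a ∈ I

/-- The radical `J` is nilpotent, and each `J ^ n ∩ S` is an ideal of `S`, so `0` or `S`. If `S ⊆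
J`, then `S * S ≠ 0` gives `S ⊆ J ^ n` for all `n` by induction, contradicting nilpotency; so `J ∩ S
= 0`. Nilpotent elements have scalar part `0`, so `J ⊆ S`. -/
theorem isSemisimpleRing_unitization [FiniteDimensional K S] (hne : ∃ x y : S, x * y ≠ 0)
    (hS : ∀ I : Submodule K S, IsTwoSidedIdeal I → I = ⊥ ∨ I = ⊤) :
    IsSemisimpleRing (Unitization K S) := by
  have : Module.Finite K (Unitization K S) := 
    Module.Finite.equiv (Unitization.linearEquiv K K S).symm
  have : IsArtinianRing (Unitization K S) := IsArtinianRing.of_finite K _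
  let J := Ring.jacobson (Unitization K S)
  have hJ : IsNilpotent J := IsSemiprimaryRing.isNilpotent
  let P : ℕ → Submodule K S := fun n =>
    ((J ^ n).restrictScalars K).comap (Unitization.inrHom K K S)
  have hP : ∀ n x, x ∈ P n ↔ (x : Unitization K S) ∈ J ^ n := fun n x => Iff.rfl
  have hPI : ∀ n, IsTwoSidedIdeal (P n) := by
    intro n a x hx
    rw [hP, hP, Unitization.inr_mul, Unitization.inr_mul]
    exact ⟨Ideal.mul_mem_left _ _ hx, Ideal.mul_mem_right _ _ hx⟩
  obtain ⟨x, y, hxy⟩ := hne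
  have hbot : P 1 = ⊥ := by
    refine (hS _ (hPI 1)).resolve_right fun htop => ?_
    have htop' : ∀ n, P n = ⊤ := by
      intro n
      induction n with
      | zero => exact eq_top_iff.2 fun z _ => by rw [hP, Submodule.pow_zero, Ideal.one_eq_top]; trivial
      | succ n ih =>
        refine (hS _ (hPI _)).resolve_left fun h0 => hxy ?_
        rw [← Submodule.mem_bot K, ← h0, hP, Unitization.inr_mul, Submodule.pow_succ]
        refine Ideal.mul_mem_mul ?_ ?_
        · rw [← hP, ih]; trivial
        · rw [← Submodule.pow_one J, ← hP, htop]; trivial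
    obtain ⟨n, hn⟩ := hJ
    have h : x * y ∈ P n := by rw [htop' n]; trivial
    rw [hP, hn] at h
    apply hxy
    apply Unitization.inr_injective (R := K)
    simpa using h
  rw [IsArtinianRing.isSemisimpleRing_iff_jacobson, eq_bot_iff]
  intro z hz
  have hfst : z.fst = 0 := by
    obtain ⟨n, hn⟩ := hJ
    have hzn : z ^ n = 0 := by
      have := Ideal.pow_mem_pow hz n
      change z ^ n ∈ J ^ n at this
      rw [hn] at this
      simpa using this
    have h := congrArg (Unitization.fstHom K S) hzn
    rw [map_pow, map_zero] at h
    exact eq_zero_of_pow_eq_zero h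
  have hz' : z = (z.snd : Unitization K S) := by
    ext
    · simpa using hfst
    · simp
  have h1 : z.snd ∈ P 1 := by
    rw [hP, Submodule.pow_one, ← hz']; exact hz
  rw [hbot, Submodule.mem_bot] at h1
  rw [hz', h1]
  simp

/-- In the semisimple unitization the ideal `S` has a complementary left ideal `L`. As `S * L ⊆ S ∩
L = 0`, the `S`-component `u` of `1` is a right unit. Each `u * x - x` is killed by `S` from the
left, and the elements so killed form a proper ideal, hence `0`. -/
theorem exists_one_of_simple [FiniteDimensional K S] (hne : ∃ x y : S, x * y ≠ 0)
    (hS : ∀ I : Submodule K S, IsTwoSidedIdeal I → I = ⊥ ∨ I = ⊤) :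
    ∃ e : S, ∀ x, e * x = x ∧ x * e = x := by
  have := isSemisimpleRing_unitization hne hS
  let T : Ideal (Unitization K S) := RingHom.ker (Unitization.fstHom K S)
  have hT : ∀ z, z ∈ T ↔ z.fst = 0 := fun z => Iff.rfl
  obtain ⟨L, hL⟩ := exists_isCompl T
  obtain ⟨u, hu, l, hl, hul⟩ := Submodule.mem_sup.1
    (hL.sup_eq_top ▸ Submodule.mem_top : (1 : Unitization K S) ∈ T ⊔ L)
  have hu' : u = (u.snd : Unitization K S) := by
    ext
    · simpa using (hT u).1 hu
    · simp
  have hr : ∀ x : S, x * u.snd = x := by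
    intro x
    have hx : (x : Unitization K S) = x * u + x * l := by rw [← mul_add, hul, mul_one]
    have h0 : (x : Unitization K S) * l = 0 := by
      have : (x : Unitization K S) * l ∈ T ⊓ L :=
        ⟨(hT _).2 (by simp), L.mul_mem_left _ hl⟩
      rwa [hL.inf_eq_bot, Submodule.mem_bot] at this
    rw [h0, add_zero, hu', ← Unitization.inr_mul] at hx
    exact (Unitization.inr_injective hx).symm
  let R : Submodule K S :=
    { carrier := {x | ∀ s : S, s * x = 0}
      zero_mem' := by simp
      add_mem' := fun {x y} hx hy s => by rw [mul_add, hx, hy, add_zero]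
      smul_mem' := fun c x hx s => by rw [mul_smul_comm, hx, smul_zero] }
  have hR : R = ⊥ := by
    refine (hS R fun a x hx => ⟨fun s => ?_, fun s => ?_⟩).resolve_right fun h => ?_
    · rw [← mul_assoc, hx]
    · rw [← mul_assoc, hx, zero_mul]
    · obtain ⟨x, y, hxy⟩ := hne
      have : y ∈ R := h ▸ Submodule.mem_top
      exact hxy (this x)
  refine ⟨u.snd, fun x => ⟨?_, hr x⟩⟩
  have : u.snd * x - x ∈ R := fun s => by rw [mul_sub, ← mul_assoc, hr, sub_self]
  rw [hR, Submodule.mem_bot] at this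
  exact sub_eq_zero.1 this

theorem exists_matrix_equiv_of_simple [IsAlgClosed K] [FiniteDimensional K S]
    (hne : ∃ x y : S, x * y ≠ 0)
    (hS : ∀ I : Submodule K S, IsTwoSidedIdeal I → I = ⊥ ∨ I = ⊤) :
    ∃ n : ℕ, 1 ≤ n ∧ ∃ e : S ≃ₗ[K] Matrix (Fin n) (Fin n) K,
      ∀ x y, e (x * y) = e x * e y := by
  obtain ⟨u, hu⟩ := exists_one_of_simple hne hS
  let : Ring S :=
    { (inferInstance : NonUnitalRing S) with
      one := u
      one_mul := fun x => (hu x).1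
      mul_one := fun x => (hu x).2 }
  let : Algebra K S := Algebra.ofModule (fun c x y => smul_mul_assoc c x y)
    (fun c x y => mul_smul_comm c x y)
  have : Nontrivial S := by
    obtain ⟨x, y, hxy⟩ := hne
    exact ⟨x * y, 0, hxy⟩
  have : IsSimpleRing S := IsSimpleRing.of_eq_bot_or_eq_top fun I => by
    let I' : Submodule K S :=
      { carrier := {x | x ∈ I}
        zero_mem' := I.zero_mem
        add_mem' := fun hx hy => I.add_mem hx hy
        smul_mem' := fun c x hx => by
          rw [Set.mem_ofPred_eq, Algebra.smul_def]; exact I.mul_mem_left _ _ hx }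
    have hI' : ∀ x, x ∈ I' ↔ x ∈ I := fun x => Iff.rfl
    refine (hS I' fun a x hx => ⟨I.mul_mem_left _ _ hx, I.mul_mem_right _ _ hx⟩).imp
      (fun h => ?_) fun h => ?_
    · ext x
      rw [← hI', h, Submodule.mem_bot, TwoSidedIdeal.mem_bot]
    · ext x
      rw [← hI', h]
      simp [TwoSidedIdeal.mem_top]
  obtain ⟨n, hn, ⟨e⟩⟩ := IsSimpleRing.exists_algEquiv_matrix_of_isAlgClosed K S
  exact ⟨n, Nat.one_le_iff_ne_zero.2 hn.ne, e.toLinearEquiv, fun x y => map_mul e x y⟩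

end SimpleAlgebra

/-! ### Trace functionals and ideals of matrix algebras. -/

section TraceForms

variable {K ι : Type*} [Field K] [Fintype ι] [DecidableEq ι]

/-- Write `E_ij = E_{i i₀} E_{i₀ j}`; the reversed product is `E_{i₀ i₀}` if `i = j` and `0`
otherwise. No division by the size is needed. -/
theorem exists_eq_smul_trace (f : Matrix ι ι K →ₗ[K] K)
    (hf : ∀ a b, f (a * b) = f (b * a)) : ∃ c : K, ∀ a, f a = c * a.trace := by
  rcases isEmpty_or_nonempty ι with h | ⟨⟨i₀⟩⟩
  · exact ⟨0, fun a => by rw [Subsingleton.elim a 0]; simp⟩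
  refine ⟨f (Matrix.single i₀ i₀ 1), fun a => ?_⟩
  have hs : ∀ i j, f (Matrix.single i j 1) = if i = j then f (Matrix.single i₀ i₀ 1) else 0 := by
    intro i j
    have h1 : Matrix.single i j (1 : K) = Matrix.single i i₀ 1 * Matrix.single i₀ j 1 := by simp
    rw [h1, hf]
    split_ifs with h
    · subst h; simp
    · rw [Matrix.single_mul_single_of_ne _ _ _ _ (Ne.symm h), map_zero]
  conv_lhs => rw [Matrix.matrix_eq_sum_single a]
  simp only [map_sum]
  have : ∀ i j, f (Matrix.single i j (a i j)) = a i j * f (Matrix.single i j 1) := by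
    intro i j
    rw [← smul_eq_mul, ← map_smul, Matrix.smul_single, smul_eq_mul, mul_one]
  rw [Matrix.trace, Finset.mul_sum]
  refine Finset.sum_congr rfl fun i _ => ?_
  rw [Finset.sum_eq_single i (fun j _ hj => by rw [this, hs, if_neg hj.symm, mul_zero])
    fun h => (h (Finset.mem_univ i)).elim, this, hs, if_pos rfl, mul_comm, Matrix.diag_apply]

theorem eq_bot_or_eq_top_of_matrix (I : Submodule K (Matrix ι ι K)) (hI : IsTwoSidedIdeal I) :
    I = ⊥ ∨ I = ⊤ := by
  rw [or_iff_not_imp_left, ← ne_eq, Submodule.ne_bot_iff]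
  rintro ⟨x, hx, hx0⟩
  obtain ⟨i, j, hij⟩ : ∃ i j, x i j ≠ 0 := by
    by_contra! h
    exact hx0 (Matrix.ext h)
  have hs : ∀ k l, Matrix.single k l (1 : K) ∈ I := by
    intro k l
    have h := (hI (Matrix.single j l (x i j)⁻¹) _ (hI (Matrix.single k i 1) x hx).1).2
    have h2 : Matrix.single k i 1 * x * Matrix.single j l (x i j)⁻¹ = Matrix.single k l 1 := by
      rw [Matrix.single_mul_mul_single, one_mul, mul_inv_cancel₀ hij]
    rwa [h2] at h
  refine eq_top_iff.2 fun a _ => ?_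
  rw [Matrix.matrix_eq_sum_single a]
  refine I.sum_mem fun k _ => I.sum_mem fun l _ => ?_
  rw [← mul_one (a k l), ← smul_eq_mul, ← Matrix.smul_single]
  exact I.smul_mem _ (hs k l)

end TraceForms

/-! ### The parity automorphism and ideals of simple superalgebras. -/

section Parity

variable {K A : Type*} [Field K] [NonUnitalRing A] [Module K A] {𝒜 : ZMod 2 → Submodule K A}

namespace IsSuperalgebra

theorem exists_add (h : IsSuperalgebra 𝒜) (x : A) :
    ∃ y ∈ 𝒜 0, ∃ z ∈ 𝒜 1, y + z = x :=
  Submodule.mem_sup.1 (h.isCompl.sup_eq_top ▸ Submodule.mem_top)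

/-- The parity automorphism, equal to `1` on the even part and to `-1` on the odd part. -/
noncomputable def parity (h : IsSuperalgebra 𝒜) : A →ₗ[K] A :=
  (𝒜 0).projection (𝒜 1) h.isCompl - (𝒜 1).projection (𝒜 0) h.isCompl.symm

theorem parity_of_even (h : IsSuperalgebra 𝒜) {x : A} (hx : x ∈ 𝒜 0) : h.parity x = x := by
  rw [parity, LinearMap.sub_apply, Submodule.projection_apply_of_mem_left _ hx,
    (Submodule.projection_apply_eq_zero_iff _).2 hx, sub_zero]

theorem parity_of_odd (h : IsSuperalgebra 𝒜) {x : A} (hx : x ∈ 𝒜 1) : h.parity x = -x := by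
  rw [parity, LinearMap.sub_apply, Submodule.projection_apply_of_mem_left _ hx,
    (Submodule.projection_apply_eq_zero_iff _).2 hx, zero_sub]

theorem parity_parity (h : IsSuperalgebra 𝒜) (x : A) : h.parity (h.parity x) = x := by
  obtain ⟨y, hy, z, hz, rfl⟩ := h.exists_add x
  simp [h.parity_of_even hy, h.parity_of_odd hz]

theorem parity_mul (h : IsSuperalgebra 𝒜) (x x' : A) :
    h.parity (x * x') = h.parity x * h.parity x' := by
  obtain ⟨y, hy, z, hz, rfl⟩ := h.exists_add x
  obtain ⟨y', hy', z', hz', rfl⟩ := h.exists_add x'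
  have h₁ := h.parity_of_even (h.mul_mem 0 0 y y' hy hy')
  have h₂ := h.parity_of_odd (h.mul_mem 0 1 y z' hy hz')
  have h₃ := h.parity_of_odd (h.mul_mem 1 0 z y' hz hy')
  have h₄ := h.parity_of_even (h.mul_mem 1 1 z z' hz hz')
  simp only [add_mul, mul_add, map_add, h₁, h₂, h₃, h₄, h.parity_of_even hy,
    h.parity_of_even hy', h.parity_of_odd hz, h.parity_of_odd hz', neg_mul, mul_neg]
  abel

variable [CharZero K]

theorem eq_zero_of_eq_neg {M : Type*} [AddCommGroup M] [Module K M] {x : M} (hx : x = -x) :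
    x = 0 := by
  have h2 : (2 : K) • x = 0 := by rw [two_smul, add_eq_zero_iff_eq_neg]; exact hx
  exact (smul_eq_zero.1 h2).resolve_left two_ne_zero

/-- Since `2` is invertible, the grading is recovered as the eigenspaces of parity. -/
theorem mem_even_iff (h : IsSuperalgebra 𝒜) {x : A} : x ∈ 𝒜 0 ↔ h.parity x = x := by
  refine ⟨h.parity_of_even, fun hx => ?_⟩
  obtain ⟨y, hy, z, hz, rfl⟩ := h.exists_add x
  rw [map_add, h.parity_of_even hy, h.parity_of_odd hz, add_right_inj] at hx
  rw [eq_zero_of_eq_neg (K := K) hx.symm, add_zero]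
  exact hy

theorem mem_odd_iff (h : IsSuperalgebra 𝒜) {x : A} : x ∈ 𝒜 1 ↔ h.parity x = -x := by
  refine ⟨h.parity_of_odd, fun hx => ?_⟩
  obtain ⟨y, hy, z, hz, rfl⟩ := h.exists_add x
  rw [map_add, h.parity_of_even hy, h.parity_of_odd hz, neg_add, add_left_inj] at hx
  rw [eq_zero_of_eq_neg (K := K) hx, zero_add]
  exact hz

theorem isGradedIdeal (h : IsSuperalgebra 𝒜) {I : Submodule K A} (hI : IsTwoSidedIdeal I)
    (hp : ∀ x ∈ I, h.parity x ∈ I) : IsGradedIdeal 𝒜 I where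
  mul_left_mem a x hx := (hI a x hx).1
  mul_right_mem a x hx := (hI a x hx).2
  graded := by
    refine le_antisymm (fun x hx => ?_) (sup_le inf_le_left inf_le_left)
    have hpx := hp x hx
    obtain ⟨y, hy, z, hz, rfl⟩ := h.exists_add x
    rw [map_add, h.parity_of_even hy, h.parity_of_odd hz] at hpx
    have hyI : y ∈ I := by
      -- Adding `x` to its parity image leaves twice its even part.
      have : (2 : K) • y ∈ I := by
        convert I.add_mem hx hpx using 1
        rw [two_smul]; abel
      exact (I.smul_mem_iff two_ne_zero).1 this
    exact Submodule.add_mem_sup ⟨hyI, hy⟩ ⟨(I.add_mem_iff_right hyI).1 hx, hz⟩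

end IsSuperalgebra

theorem isTwoSidedIdeal_map_of_surjective {A' : Type*} [NonUnitalRing A'] [Module K A']
    {I : Submodule K A} (hI : IsTwoSidedIdeal I) (f : A →ₗ[K] A')
    (hf : ∀ x y, f (x * y) = f x * f y) (hs : Function.Surjective f) :
    IsTwoSidedIdeal (I.map f) := by
  rintro a _ ⟨x, hx, rfl⟩
  obtain ⟨b, rfl⟩ := hs a
  exact ⟨⟨b * x, (hI b x hx).1, hf _ _⟩, ⟨x * b, (hI b x hx).2, hf _ _⟩⟩

theorem IsTwoSidedIdeal.inf {I J : Submodule K A} (hI : IsTwoSidedIdeal I)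
    (hJ : IsTwoSidedIdeal J) : IsTwoSidedIdeal (I ⊓ J) := fun a x hx =>
  ⟨⟨(hI a x hx.1).1, (hJ a x hx.2).1⟩, ⟨(hI a x hx.1).2, (hJ a x hx.2).2⟩⟩

theorem IsTwoSidedIdeal.sup {I J : Submodule K A} (hI : IsTwoSidedIdeal I)
    (hJ : IsTwoSidedIdeal J) : IsTwoSidedIdeal (I ⊔ J) := by
  intro a x hx
  obtain ⟨y, hy, z, hz, rfl⟩ := Submodule.mem_sup.1 hx
  rw [mul_add, add_mul]
  exact ⟨Submodule.add_mem_sup (hI a y hy).1 (hJ a z hz).1,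
    Submodule.add_mem_sup (hI a y hy).2 (hJ a z hz).2⟩

/-- A nonzero proper ideal of a simple superalgebra is a complement of its parity conjugate. -/
theorem IsSimpleSuperalgebra.isCompl_map_parity [CharZero K] (h : IsSimpleSuperalgebra 𝒜)
    {I : Submodule K A} (hI : IsTwoSidedIdeal I) (hbot : I ≠ ⊥) (htop : I ≠ ⊤) :
    IsCompl I (I.map h.superalgebra.parity) := by
  have hσ := h.superalgebra.parity_parity
  have hI' : IsTwoSidedIdeal (I.map h.superalgebra.parity) :=
    isTwoSidedIdeal_map_of_surjective hI _ h.superalgebra.parity_mul fun x => ⟨_, hσ x⟩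
  have hmem : ∀ x ∈ I.map h.superalgebra.parity, h.superalgebra.parity x ∈ I := by
    rintro _ ⟨x, hx, rfl⟩
    rwa [hσ]
  have h₁ : I ⊓ I.map h.superalgebra.parity = ⊥ :=
    (h.eq_bot_or_eq_top _ (h.superalgebra.isGradedIdeal (hI.inf hI') fun x hx =>
      ⟨hmem x hx.2, Submodule.mem_map_of_mem hx.1⟩)).resolve_right
      fun h' => htop (eq_top_iff.2 (h' ▸ inf_le_left))
  have h₂ : I ⊔ I.map h.superalgebra.parity = ⊤ := by
    refine (h.eq_bot_or_eq_top _ (h.superalgebra.isGradedIdeal (hI.sup hI') fun x hx => ?_)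
      ).resolve_left fun h' => hbot (eq_bot_iff.2 (h' ▸ le_sup_left))
    obtain ⟨y, hy, z, hz, rfl⟩ := Submodule.mem_sup.1 hx
    rw [map_add, add_comm]
    exact Submodule.add_mem_sup (hmem z hz) (Submodule.mem_map_of_mem hy)
  exact ⟨disjoint_iff.2 h₁, codisjoint_iff.2 h₂⟩

/-- Both products lie in `I ∩ σI = 0`. -/
theorem IsSimpleSuperalgebra.parity_mul_eq_zero [CharZero K] (h : IsSimpleSuperalgebra 𝒜)
    {I : Submodule K A} (hI : IsTwoSidedIdeal I) (hbot : I ≠ ⊥) (htop : I ≠ ⊤) {x y : A}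
    (hx : x ∈ I) (hy : y ∈ I) :
    h.superalgebra.parity x * y = 0 ∧ x * h.superalgebra.parity y = 0 := by
  have hc := (h.isCompl_map_parity hI hbot htop).disjoint.le_bot
  have hI' : IsTwoSidedIdeal (I.map h.superalgebra.parity) :=
    isTwoSidedIdeal_map_of_surjective hI _ h.superalgebra.parity_mul
      fun x => ⟨_, h.superalgebra.parity_parity x⟩
  exact ⟨hc ⟨(hI _ _ hy).1, (hI' _ _ (Submodule.mem_map_of_mem hx)).2⟩,
    hc ⟨(hI _ _ hx).2, (hI' _ _ (Submodule.mem_map_of_mem hy)).1⟩⟩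

/-- A nonzero proper ideal of a simple superalgebra is a simple algebra. -/
theorem IsSimpleSuperalgebra.eq_bot_or_eq_of_le [CharZero K] (h : IsSimpleSuperalgebra 𝒜)
    {I : Submodule K A} (hI : IsTwoSidedIdeal I) (hbot : I ≠ ⊥) (htop : I ≠ ⊤)
    {J : Submodule K A} (hJI : J ≤ I) (hJ : ∀ a ∈ I, ∀ x ∈ J, a * x ∈ J ∧ x * a ∈ J) :
    J = ⊥ ∨ J = I := by
  rw [or_iff_not_imp_left]
  intro hJbot
  have hc := h.isCompl_map_parity hI hbot htop
  -- The summand `σI` annihilates `J`, so an ideal of `I` is already an ideal of `A`.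
  have hJ' : IsTwoSidedIdeal J := by
    intro a x hx
    obtain ⟨y, hy, _, ⟨z, hz, rfl⟩, rfl⟩ := Submodule.mem_sup.1
      (hc.sup_eq_top ▸ Submodule.mem_top : a ∈ I ⊔ I.map h.superalgebra.parity)
    rw [add_mul, mul_add, (h.parity_mul_eq_zero hI hbot htop hz (hJI hx)).1,
      (h.parity_mul_eq_zero hI hbot htop (hJI hx) hz).2, add_zero, add_zero]
    exact hJ y hy x hx
  have hJtop : J ≠ ⊤ := fun h' => htop (eq_top_iff.2 (h' ▸ hJI))
  have hcJ := h.isCompl_map_parity hJ' hJbot hJtop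
  -- Now `A = J ⊕ σJ`; the `σJ`-component of an element of `I` lies in `I ∩ σI = 0`.
  refine le_antisymm hJI fun x hx => ?_
  obtain ⟨y, hy, z, hz, rfl⟩ := Submodule.mem_sup.1
    (hcJ.sup_eq_top ▸ Submodule.mem_top : x ∈ J ⊔ J.map h.superalgebra.parity)
  have hz0 : z = 0 := hc.disjoint.le_bot
    ⟨(I.add_mem_iff_right (hJI hy)).1 hx, Submodule.map_mono hJI hz⟩
  rwa [hz0, add_zero]

end Parity

/-! ### Odd-symmetric forms and their absence on matrix algebras. -/

section Forms

variable {K A : Type*} [Field K] [NonUnitalRing A] [Module K A] {𝒜 : ZMod 2 → Submodule K A}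
  {B : LinearMap.BilinForm K A}

theorem IsOddSymmetric.even_even (hB : IsOddSymmetric 𝒜 B) {x y : A} (hx : x ∈ 𝒜 0)
    (hy : y ∈ 𝒜 0) : B x y = 0 := hB.odd 0 0 x y hx hy (by decide)

theorem IsOddSymmetric.odd_odd (hB : IsOddSymmetric 𝒜 B) {x y : A} (hx : x ∈ 𝒜 1)
    (hy : y ∈ 𝒜 1) : B x y = 0 := hB.odd 1 1 x y hx hy (by decide)

/-- The sign differs from `1` only on odd-odd pairs, where an odd form vanishes. -/
theorem IsOddSymmetric.symm (h : IsSuperalgebra 𝒜) (hB : IsOddSymmetric 𝒜 B) (x y : A) :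
    B x y = B y x := by
  obtain ⟨x₀, hx₀, x₁, hx₁, rfl⟩ := h.exists_add x
  obtain ⟨y₀, hy₀, y₁, hy₁, rfl⟩ := h.exists_add y
  have h₁ := hB.supersymmetric 0 1 x₀ y₁ hx₀ hy₁
  have h₂ := hB.supersymmetric 1 0 x₁ y₀ hx₁ hy₀
  simp only [ZMod.val_zero, zero_mul, mul_zero, pow_zero, one_mul] at h₁ h₂
  simp only [map_add, LinearMap.add_apply, hB.even_even hx₀ hy₀, hB.even_even hy₀ hx₀,
    hB.odd_odd hx₁ hy₁, hB.odd_odd hy₁ hx₁, h₁, h₂]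
  ring

/-- A superalgebra whose underlying algebra is a full matrix algebra has no odd-symmetric
structure. -/
theorem not_isOddSymmetric_of_matrix [CharZero K] {ι : Type*} [Fintype ι] [DecidableEq ι]
    [Nonempty ι] (h : IsSuperalgebra 𝒜) (e : A ≃ₗ[K] Matrix ι ι K)
    (he : ∀ x y, e (x * y) = e x * e y) : ¬ IsOddSymmetric 𝒜 B := by
  intro hB
  have he' : ∀ x y, e.symm (x * y) = e.symm x * e.symm y := fun x y =>
    e.injective (by simp [he])
  obtain ⟨u, hu⟩ : ∃ u, e u = 1 := ⟨e.symm 1, by simp⟩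
  have hu₁ : ∀ x, u * x = x := fun x => e.injective (by rw [he, hu, one_mul])
  have hu₂ : ∀ x, x * u = x := fun x => e.injective (by rw [he, hu, mul_one])
  -- A multiplicative involution fixes the unit, whatever the grading.
  have hu0 : u ∈ 𝒜 0 := by
    rw [h.mem_even_iff, ← hu₁ (h.parity u)]
    nth_rw 1 [← h.parity_parity u]
    rw [← h.parity_mul, hu₂, h.parity_parity]
  obtain ⟨c, hc⟩ := exists_eq_smul_trace (B u ∘ₗ e.symm.toLinearMap) (fun a b => by
    simp only [LinearMap.comp_apply, LinearEquiv.coe_coe, he']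
    rw [← hB.assoc, hu₁, ← hB.assoc, hu₁, hB.symm h])
  have hc0 : c = 0 := by
    have h1 := hc 1
    simp only [LinearMap.comp_apply, LinearEquiv.coe_coe, ← hu, e.symm_apply_apply,
      hB.even_even hu0 hu0] at h1
    rw [hu, Matrix.trace_one] at h1
    exact (mul_eq_zero.1 h1.symm).resolve_right (by simp)
  have hu' : u = 0 := hB.nondegenerate u fun y => by
    have := hc (e y)
    simpa [hc0] using this
  rw [hu', map_zero] at hu
  exact zero_ne_one hu

end Forms

theorem zmod_two_eq (i : ZMod 2) : i = 0 ∨ i = 1 := by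
  revert i; decide

/-! ### The superalgebras `M_{r,s}(K)`. -/

section Mat

variable (K : Type*) [Field K]

theorem isSuperalgebra_matGrading (r s : ℕ) : IsSuperalgebra (matGrading K r s) where
  isCompl := by
    refine ⟨Submodule.disjoint_def.2 ?_, codisjoint_iff.2 (eq_top_iff.2 fun x _ => ?_)⟩
    · rintro _ ⟨a, b, rfl⟩ ⟨c, d, h⟩
      obtain ⟨rfl, -, -, rfl⟩ := Matrix.fromBlocks_inj.1 h
      exact Matrix.fromBlocks_zero
    · refine Submodule.mem_sup.2 ⟨_, ⟨x.toBlocks₁₁, x.toBlocks₂₂, rfl⟩,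
        _, ⟨x.toBlocks₁₂, x.toBlocks₂₁, rfl⟩, ?_⟩
      simp [Matrix.fromBlocks_add, Matrix.fromBlocks_toBlocks]
  mul_mem i j x y hx hy := by
    rcases zmod_two_eq i with rfl | rfl <;> rcases zmod_two_eq j with rfl | rfl <;>
    obtain ⟨a, b, rfl⟩ := hx <;> obtain ⟨a', b', rfl⟩ := hy <;>
    rw [Matrix.fromBlocks_multiply]
    · exact ⟨a * a', b * b', by simp⟩
    · exact ⟨a * a', b * b', by simp⟩
    · exact ⟨a * b', b * a', by simp⟩
    · exact ⟨a * b', b * a', by simp⟩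

theorem isSimpleSuperalgebra_matGrading (r s : ℕ) (hr : 1 ≤ r) :
    IsSimpleSuperalgebra (matGrading K r s) where
  superalgebra := isSuperalgebra_matGrading K r s
  exists_mul_ne_zero := by
    have : Nonempty (Fin r ⊕ Fin s) := ⟨Sum.inl ⟨0, hr⟩⟩
    exact ⟨1, 1, by simp⟩
  eq_bot_or_eq_top I hI :=
    eq_bot_or_eq_top_of_matrix I fun a x hx => ⟨hI.mul_left_mem a x hx, hI.mul_right_mem a x hx⟩

end Mat

/-! ### The superalgebras `Q_n(K)` and their forms. -/

section Queer

variable {K : Type*} [Field K] {n : ℕ}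

/-- The linear coordinates `(a, b) ↦ ã + b̄` on `Q_n(K)`. -/
def queerEquiv : (Matrix (Fin n) (Fin n) K × Matrix (Fin n) (Fin n) K) ≃ₗ[K] Queer K n where
  toFun p := ⟨Matrix.fromBlocks p.1 p.2 p.2 p.1, p.1, p.2, rfl⟩
  map_add' p q := Subtype.ext (by simp [Matrix.fromBlocks_add])
  map_smul' c p := Subtype.ext (by simp [Matrix.fromBlocks_smul])
  invFun x := (x.1.toBlocks₁₁, x.1.toBlocks₁₂)
  left_inv p := rfl
  right_inv := by
    rintro ⟨_, a, b, rfl⟩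
    rfl

theorem queerEquiv_mul (a b a' b' : Matrix (Fin n) (Fin n) K) :
    queerEquiv (a, b) * queerEquiv (a', b') = queerEquiv (a * a' + b * b', a * b' + b * a') :=
  Subtype.ext (by
    change Matrix.fromBlocks a b b a * Matrix.fromBlocks a' b' b' a' =
      Matrix.fromBlocks (a * a' + b * b') (a * b' + b * a') _ _
    rw [Matrix.fromBlocks_multiply, add_comm (b * a'), add_comm (b * b')])

theorem queerEquiv_one : queerEquiv (1, 0) = (1 : Queer K n) :=
  Subtype.ext Matrix.fromBlocks_one

theorem queerEven_eq (a : Matrix (Fin n) (Fin n) K) : queerEven a = queerEquiv (a, 0) := rfl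

theorem queerOdd_eq (b : Matrix (Fin n) (Fin n) K) : queerOdd b = queerEquiv (0, b) := rfl

theorem queerForm_apply (a b a' b' : Matrix (Fin n) (Fin n) K) :
    queerForm K n (queerEquiv (a, b)) (queerEquiv (a', b')) =
      (a * b').trace + (b * a').trace := rfl

theorem mem_queerGrading_zero {a b : Matrix (Fin n) (Fin n) K} :
    queerEquiv (a, b) ∈ queerGrading K n 0 ↔ b = 0 := by
  refine ⟨?_, ?_⟩
  · rintro ⟨c, d, h⟩
    exact (Matrix.fromBlocks_inj.1 h).2.1
  · rintro rfl
    exact ⟨a, a, rfl⟩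

theorem mem_queerGrading_one {a b : Matrix (Fin n) (Fin n) K} :
    queerEquiv (a, b) ∈ queerGrading K n 1 ↔ a = 0 := by
  refine ⟨?_, ?_⟩
  · rintro ⟨c, d, h⟩
    exact (Matrix.fromBlocks_inj.1 h).1
  · rintro rfl
    exact ⟨b, b, rfl⟩

theorem queer_forall {P : Queer K n → Prop} (h : ∀ a b, P (queerEquiv (a, b))) (x) : P x := by
  obtain ⟨⟨a, b⟩, rfl⟩ := queerEquiv.surjective x
  exact h a b

variable (K n)

theorem isSuperalgebra_queerGrading : IsSuperalgebra (queerGrading K n) where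
  isCompl := by
    refine ⟨Submodule.disjoint_def.2 (queer_forall fun a b h₀ h₁ => ?_),
      codisjoint_iff.2 (eq_top_iff.2 fun x _ => ?_)⟩
    · rw [mem_queerGrading_zero.1 h₀, mem_queerGrading_one.1 h₁]
      exact map_zero queerEquiv
    · induction x using queer_forall with | h a b =>
      refine Submodule.mem_sup.2 ⟨_, mem_queerGrading_zero.2 rfl, _, mem_queerGrading_one.2 rfl,
        (map_add queerEquiv (a, 0) (0, b)).symm.trans ?_⟩
      simp
  mul_mem i j x y hx hy := (isSuperalgebra_matGrading K n n).mul_mem i j _ _ hx hy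

variable {K n}

/-- Multiplication by the odd element `queerEquiv (0, 1)` turns the odd component into an even one,
so a graded ideal is determined by its even part, an ideal of `M_n(K)`. -/
theorem queerEquiv_mem_of_isGradedIdeal {I : Submodule K (Queer K n)}
    (hI : IsGradedIdeal (queerGrading K n) I) {a b : Matrix (Fin n) (Fin n) K}
    (h : queerEquiv (a, b) ∈ I) : queerEquiv (a, 0) ∈ I ∧ queerEquiv (b, 0) ∈ I := by
  rw [hI.graded] at h
  obtain ⟨x, ⟨hxI, hx⟩, y, ⟨hyI, hy⟩, hxy⟩ := Submodule.mem_sup.1 h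
  obtain ⟨⟨c, d⟩, rfl⟩ := queerEquiv.surjective x
  obtain ⟨⟨c', d'⟩, rfl⟩ := queerEquiv.surjective y
  obtain rfl := mem_queerGrading_zero.1 hx
  obtain rfl := mem_queerGrading_one.1 hy
  rw [← map_add, queerEquiv.injective.eq_iff] at hxy
  obtain ⟨rfl, rfl⟩ : c = a ∧ d' = b := by simpa using hxy
  refine ⟨hxI, ?_⟩
  have := hI.mul_left_mem (queerEquiv (0, 1)) _ hyI
  simpa [queerEquiv_mul] using this

theorem isSimpleSuperalgebra_queerGrading (hn : 1 ≤ n) :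
    IsSimpleSuperalgebra (queerGrading K n) where
  superalgebra := isSuperalgebra_queerGrading K n
  exists_mul_ne_zero := by
    have : Nonempty (Fin n) := ⟨⟨0, hn⟩⟩
    refine ⟨1, 1, ?_⟩
    rw [mul_one, ← queerEquiv_one, ne_eq, LinearEquiv.map_eq_zero_iff]
    simp
  eq_bot_or_eq_top I hI := by
    let J : Submodule K (Matrix (Fin n) (Fin n) K) :=
      I.comap (queerEquiv.toLinearMap ∘ₗ LinearMap.inl K _ _)
    have hJmem : ∀ a, a ∈ J ↔ queerEquiv (a, 0) ∈ I := fun a => Iff.rfl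
    have hJ : IsTwoSidedIdeal J := by
      intro a x hx
      rw [hJmem] at hx
      have h₁ := hI.mul_left_mem (queerEquiv (a, 0)) _ hx
      have h₂ := hI.mul_right_mem (queerEquiv (a, 0)) _ hx
      simp only [queerEquiv_mul, mul_zero, zero_mul, add_zero] at h₁ h₂
      exact ⟨h₁, h₂⟩
    refine (eq_bot_or_eq_top_of_matrix J hJ).imp (fun h => ?_) fun h => ?_
    · refine eq_bot_iff.2 (queer_forall fun a b hx => ?_)
      obtain ⟨ha, hb⟩ := queerEquiv_mem_of_isGradedIdeal hI hx
      rw [← hJmem, h, Submodule.mem_bot] at ha hb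
      rw [ha, hb]
      exact map_zero queerEquiv
    · have h1 : (1 : Queer K n) ∈ I := by
        rw [← queerEquiv_one, ← hJmem, h]; trivial
      exact eq_top_iff.2 fun x _ => by simpa using hI.mul_left_mem x 1 h1

theorem isOddSymmetric_queerForm : IsOddSymmetric (queerGrading K n) (queerForm K n) where
  odd i j x y := by
    induction x using queer_forall with | h a b =>
    induction y using queer_forall with | h a' b' =>
    rcases zmod_two_eq i with rfl | rfl <;> rcases zmod_two_eq j with rfl | rfl <;>
      simp only [mem_queerGrading_zero, mem_queerGrading_one, queerForm_apply] <;>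
      rintro rfl rfl h
    · simp
    · exact (h (by decide)).elim
    · exact (h (by decide)).elim
    · simp
  supersymmetric i j x y := by
    induction x using queer_forall with | h a b =>
    induction y using queer_forall with | h a' b' =>
    rcases zmod_two_eq i with rfl | rfl <;> rcases zmod_two_eq j with rfl | rfl <;>
      simp only [mem_queerGrading_zero, mem_queerGrading_one, queerForm_apply] <;>
      rintro rfl rfl
    · simp
    · simp [Matrix.trace_mul_comm a]
    · simp [Matrix.trace_mul_comm b]
    · simp
  assoc x y z := by
    induction x using queer_forall with | h a b =>
    induction y using queer_forall with | h a' b' =>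
    induction z using queer_forall with | h a'' b'' =>
    simp only [queerEquiv_mul, queerForm_apply, ← Matrix.trace_add]
    congr 1
    noncomm_ring
  nondegenerate := by
    refine queer_forall fun a b h => ?_
    have ha : a = 0 := Matrix.ext_iff_trace_mul_right.2 fun x => by
      simpa [queerForm_apply] using h (queerEquiv (0, x))
    have hb : b = 0 := Matrix.ext_iff_trace_mul_right.2 fun x => by
      simpa [queerForm_apply] using h (queerEquiv (x, 0))
    rw [ha, hb]
    exact map_zero queerEquiv

/-- By associativity `B x y = B 1 (x * y)`. The functional `B 1` kills the even part, and on the odd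
part it is a trace functional, by symmetry of `B` on pairs `ã`, `b̄`. -/
theorem exists_eq_smul_queerForm (hn : 1 ≤ n) {B : LinearMap.BilinForm K (Queer K n)}
    (hB : IsOddSymmetric (queerGrading K n) B) :
    ∃ c : K, c ≠ 0 ∧ B = c • queerForm K n := by
  have hs := hB.symm (isSuperalgebra_queerGrading K n)
  have h1 : ∀ x y, B 1 (x * y) = B x y := fun x y => by rw [← hB.assoc, one_mul]
  obtain ⟨c, hc⟩ := exists_eq_smul_trace
    (B 1 ∘ₗ queerEquiv.toLinearMap ∘ₗ LinearMap.inr K _ _) (fun a b => by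
      have h₁ := h1 (queerEquiv (a, 0)) (queerEquiv (0, b))
      have h₂ := h1 (queerEquiv (0, b)) (queerEquiv (a, 0))
      simp only [queerEquiv_mul, mul_zero, zero_mul, add_zero, zero_add] at h₁ h₂
      exact h₁.trans ((hs _ _).trans h₂.symm))
  have hB' : B = c • queerForm K n := by
    refine LinearMap.ext₂ (queer_forall fun a b => queer_forall fun a' b' => ?_)
    have hsplit : ∀ p q : Matrix (Fin n) (Fin n) K,
        B 1 (queerEquiv (p, q)) = c * q.trace := by
      intro p q
      have h0 : B 1 (queerEquiv (p, 0)) = 0 := by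
        rw [← queerEquiv_one]
        exact hB.even_even (mem_queerGrading_zero.2 rfl) (mem_queerGrading_zero.2 rfl)
      have : (p, q) = (p, 0) + (0, q) := by simp
      rw [this, map_add, map_add, h0, zero_add]
      exact hc q
    rw [← h1, queerEquiv_mul, hsplit, Matrix.trace_add]
    rfl
  refine ⟨c, ?_, hB'⟩
  rintro rfl
  have : Nonempty (Fin n) := ⟨⟨0, hn⟩⟩
  have h0 := hB.nondegenerate (queerEquiv (1, 0)) fun y => by simp [hB']
  rw [LinearEquiv.map_eq_zero_iff] at h0
  simp at h0

end Queer

/-! ### Classification of the simple superalgebras with an odd-symmetric structure. -/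

section Classification

variable {K A : Type*} [Field K] [NonUnitalRing A] [Module K A] {𝒜 : ZMod 2 → Submodule K A}

theorem IsOddSymmetric.exists_of_isomorphic {A' : Type*} [NonUnitalRing A'] [Module K A']
    {𝒜' : ZMod 2 → Submodule K A'} (h : Isomorphic 𝒜 𝒜') {B : LinearMap.BilinForm K A'}
    (hB : IsOddSymmetric 𝒜' B) : ∃ B : LinearMap.BilinForm K A, IsOddSymmetric 𝒜 B := by
  obtain ⟨e, he, hg⟩ := h
  refine ⟨B.compl₁₂ e.toLinearMap e.toLinearMap, ?_, ?_, ?_, ?_⟩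
  · exact fun i j x y hx hy => hB.odd i j _ _ ((hg i x).1 hx) ((hg j y).1 hy)
  · exact fun i j x y hx hy => hB.supersymmetric i j _ _ ((hg i x).1 hx) ((hg j y).1 hy)
  · intro x y z
    simp [he, hB.assoc]
  · intro x hx
    refine e.map_eq_zero_iff.1 (hB.nondegenerate _ fun y => ?_)
    simpa using hx (e.symm y)

theorem mul_comm_of_isomorphic_queer_one (h : Isomorphic 𝒜 (queerGrading K 1)) (x y : A) :
    x * y = y * x := by
  obtain ⟨e, he, -⟩ := h
  apply e.injective
  rw [he, he]
  obtain ⟨⟨a, b⟩, hx⟩ := queerEquiv.surjective (e x)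
  obtain ⟨⟨a', b'⟩, hy⟩ := queerEquiv.surjective (e y)
  have hcomm : ∀ p q : Matrix (Fin 1) (Fin 1) K, p * q = q * p := fun p q => by
    ext i j
    fin_cases i; fin_cases j
    simp [Matrix.mul_apply, mul_comm]
  rw [← hx, ← hy, queerEquiv_mul, queerEquiv_mul, hcomm a a', hcomm b b', hcomm a b',
    hcomm b a', add_comm (b' * a)]

theorem eq_one_of_isomorphic_queer {n : ℕ} (hn : 1 ≤ n) (h : Isomorphic 𝒜 (queerGrading K n))
    (hcomm : ∀ x y : A, x * y = y * x) : n = 1 := by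
  obtain ⟨e, he, -⟩ := h
  by_contra hn1
  -- For `i ≠ j`, `E_ii E_ij = E_ij` but `E_ij E_ii = 0`.
  let i : Fin n := ⟨0, hn⟩
  let j : Fin n := ⟨1, by omega⟩
  have hij : i ≠ j := by simp [i, j, Fin.ext_iff]
  have hc := hcomm (e.symm (queerEquiv (Matrix.single i i 1, 0)))
    (e.symm (queerEquiv (Matrix.single i j 1, 0)))
  have hc' := congrArg e hc
  rw [he, he, e.apply_symm_apply, e.apply_symm_apply, queerEquiv_mul, queerEquiv_mul,
    queerEquiv.injective.eq_iff] at hc'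
  have h1 := congrFun (congrFun (congrArg Prod.fst hc') i) j
  simp [hij.symm] at h1

theorem not_isSupercommutative_of_isomorphic_queer [CharZero K] {n : ℕ} (hn : 1 ≤ n)
    (h : Isomorphic 𝒜 (queerGrading K n)) : ¬ IsSupercommutative 𝒜 := by
  obtain ⟨e, he, hg⟩ := h
  intro hs
  -- The sign rule forces odd elements to square to zero, but this one squares to `1`.
  obtain ⟨x, hx⟩ := e.surjective (queerEquiv (0, 1))
  have hx1 : x ∈ 𝒜 1 := (hg 1 x).2 (hx ▸ mem_queerGrading_one.2 rfl)
  have hxx := hs 1 1 x x hx1 hx1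
  rw [ZMod.val_one, mul_one, pow_one, neg_one_smul] at hxx
  have h0 := congrArg e (IsSuperalgebra.eq_zero_of_eq_neg (K := K) hxx)
  rw [he, hx, map_zero, queerEquiv_mul, LinearEquiv.map_eq_zero_iff] at h0
  have : Nonempty (Fin n) := ⟨⟨0, hn⟩⟩
  simp at h0

variable [IsScalarTower K A A] [SMulCommClass K A A] [FiniteDimensional K A]

/-- A simple superalgebra that is not simple as an ungraded algebra is some `Q_n(K)`. -/
theorem IsSimpleSuperalgebra.isomorphic_queer [IsAlgClosed K] [CharZero K]
    (h : IsSimpleSuperalgebra 𝒜) {I : Submodule K A} (hI : IsTwoSidedIdeal I) (hbot : I ≠ ⊥)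
    (htop : I ≠ ⊤) : ∃ n : ℕ, 1 ≤ n ∧ Isomorphic 𝒜 (queerGrading K n) := by
  have hc := h.isCompl_map_parity hI hbot htop
  have hz := fun {x y} => h.parity_mul_eq_zero hI hbot htop (x := x) (y := y)
  have hsimple := fun {J} => h.eq_bot_or_eq_of_le hI hbot htop (J := J)
  have hσσ := h.superalgebra.parity_parity
  have hσm := h.superalgebra.parity_mul
  have hev := fun {x} => h.superalgebra.mem_even_iff (x := x)
  have hod := fun {x} => h.superalgebra.mem_odd_iff (x := x)
  generalize h.superalgebra.parity = σ at *
  let S : NonUnitalSubalgebra K A :=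
    { I with mul_mem' := fun {a b} _ hb => (hI a b hb).1 }
  let ι : S →ₗ[K] A := I.subtype
  have hι : Function.Injective ι := Subtype.val_injective
  have hιm : ∀ x y : S, ι (x * y) = ι x * ι y := fun x y => rfl
  have hιI : ∀ x : S, ι x ∈ I := fun x => x.2
  have : FiniteDimensional K S := FiniteDimensional.of_injective ι hι
  -- If `I * I = 0`, then `σI * σI = 0` too, and the cross products vanish, so `A * A = 0`.
  obtain ⟨n, hn, φ, hφ⟩ := exists_matrix_equiv_of_simple (K := K) (S := S) (by
    by_contra! h0
    have h0' : ∀ x ∈ I, ∀ y ∈ I, x * y = 0 := fun x hx y hy =>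
      congrArg Subtype.val (h0 ⟨x, hx⟩ ⟨y, hy⟩)
    obtain ⟨x, y, hxy⟩ := h.exists_mul_ne_zero
    obtain ⟨x₁, hx₁, _, ⟨x₂, hx₂, rfl⟩, rfl⟩ := Submodule.mem_sup.1
      (hc.sup_eq_top ▸ Submodule.mem_top : x ∈ I ⊔ I.map σ)
    obtain ⟨y₁, hy₁, _, ⟨y₂, hy₂, rfl⟩, rfl⟩ := Submodule.mem_sup.1
      (hc.sup_eq_top ▸ Submodule.mem_top : y ∈ I ⊔ I.map σ)
    apply hxy
    rw [add_mul, mul_add, mul_add, (hz hx₂ hy₁).1, (hz hx₁ hy₂).2, ← hσm, h0' _ hx₁ _ hy₁,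
      h0' _ hx₂ _ hy₂, map_zero]
    simp) (by
    intro J hJ
    have hle : J.map ι ≤ I := by
      rintro _ ⟨x, -, rfl⟩
      exact hιI x
    refine (hsimple hle ?_).imp (fun h0 => ?_) fun h0 => ?_
    · rintro a ha _ ⟨x, hx, rfl⟩
      exact ⟨⟨_, (hJ ⟨a, ha⟩ x hx).1, rfl⟩, ⟨_, (hJ ⟨a, ha⟩ x hx).2, rfl⟩⟩
    · exact Submodule.map_injective_of_injective hι (h0.trans (Submodule.map_bot ι).symm)
    · refine eq_top_iff.2 fun x _ => ?_
      obtain ⟨y, hy, hyx⟩ : ι x ∈ J.map ι := h0 ▸ hιI x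
      rwa [← hι hyx])
  let ψ : Matrix (Fin n) (Fin n) K →ₗ[K] A := ι ∘ₗ φ.symm.toLinearMap
  have hψ : Function.Injective ψ := hι.comp φ.symm.injective
  have hψI : ∀ a, ψ a ∈ I := fun a => hιI _
  have hψs : ∀ x ∈ I, ∃ a, ψ a = x := fun x hx => ⟨φ ⟨x, hx⟩, by
    simp only [ψ, LinearMap.comp_apply, LinearEquiv.coe_coe, φ.symm_apply_apply]
    rfl⟩
  have hψm : ∀ a b, ψ (a * b) = ψ a * ψ b := fun a b => by
    have : φ.symm (a * b) = φ.symm a * φ.symm b := φ.injective (by simp [hφ])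
    simp only [ψ, LinearMap.comp_apply, LinearEquiv.coe_coe, this, hιm]
  -- In `Q_n`, `ã + b̄ ↦ (a + b, a - b)` is an isomorphism onto `M_n × M_n`, and parity `b ↦ -b`
  -- swaps the factors. Here the factors are `I` and `σI`.
  let T : (Matrix (Fin n) (Fin n) K × Matrix (Fin n) (Fin n) K) →ₗ[K] A :=
    ψ ∘ₗ (LinearMap.fst K _ _ + LinearMap.snd K _ _) +
      σ ∘ₗ ψ ∘ₗ (LinearMap.fst K _ _ - LinearMap.snd K _ _)
  have hT : ∀ a b, T (a, b) = ψ (a + b) + σ (ψ (a - b)) := fun a b => rfl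
  have hσT : ∀ a b, σ (T (a, b)) = T (a, -b) := fun a b => by
    rw [hT, hT, map_add, hσσ, sub_neg_eq_add, ← sub_eq_add_neg, add_comm]
  have hTm : ∀ a b a' b', T (a, b) * T (a', b') = T (a * a' + b * b', a * b' + b * a') := by
    intro a b a' b'
    rw [hT, hT, hT, add_mul, mul_add, mul_add, (hz (hψI _) (hψI _)).1, (hz (hψI _) (hψI _)).2,
      ← hσm, ← hψm, ← hψm, add_zero, zero_add]
    congr 3
    · noncomm_ring
    · noncomm_ring
  have h2 : ∀ x : Matrix (Fin n) (Fin n) K, (2⁻¹ : K) • (x + x) = x := fun x => by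
    rw [← two_smul K, smul_smul, inv_mul_cancel₀ two_ne_zero, one_smul]
  have hTi : Function.Injective T := by
    rw [injective_iff_map_eq_zero]
    rintro ⟨a, b⟩ h0
    rw [hT] at h0
    have h₁ : ψ (a + b) = 0 := hc.disjoint.le_bot ⟨hψI _, by
      rw [eq_neg_of_add_eq_zero_left h0]
      exact neg_mem (Submodule.mem_map_of_mem (hψI _))⟩
    rw [h₁, zero_add] at h0
    have h₂ : ψ (a - b) = 0 := by rw [← hσσ (ψ (a - b)), h0, map_zero]
    have h₁ : a + b = 0 := hψ (by rw [h₁, map_zero])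
    have h₂ : a - b = 0 := hψ (by rw [h₂, map_zero])
    obtain rfl := sub_eq_zero.1 h₂
    have := h2 a
    rw [h₁, smul_zero] at this
    rw [← this]; rfl
  have hTs : Function.Surjective T := by
    intro x
    obtain ⟨y, hy, _, ⟨z, hz, rfl⟩, rfl⟩ := Submodule.mem_sup.1
      (hc.sup_eq_top ▸ Submodule.mem_top : x ∈ I ⊔ I.map σ)
    obtain ⟨a, rfl⟩ := hψs y hy
    obtain ⟨b, rfl⟩ := hψs z hz
    -- The solution of `p + q = a`, `p - q = b`.
    refine ⟨((2⁻¹ : K) • (a + b), (2⁻¹ : K) • (a - b)), ?_⟩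
    rw [hT, ← smul_add, ← smul_sub, add_add_sub_cancel, add_sub_sub_cancel, h2, h2]
  let e := (LinearEquiv.ofBijective T ⟨hTi, hTs⟩).symm.trans queerEquiv
  have he : ∀ a b, e (T (a, b)) = queerEquiv (a, b) := fun a b => by
    have : (LinearEquiv.ofBijective T ⟨hTi, hTs⟩).symm (T (a, b)) = (a, b) :=
      (LinearEquiv.symm_apply_eq _).2 rfl
    simp only [e, LinearEquiv.trans_apply, this]
  refine ⟨n, hn, e, fun x y => ?_, fun i x => ?_⟩
  · obtain ⟨⟨a, b⟩, rfl⟩ := hTs x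
    obtain ⟨⟨a', b'⟩, rfl⟩ := hTs y
    rw [hTm, he, he, he, queerEquiv_mul]
  · obtain ⟨⟨a, b⟩, rfl⟩ := hTs x
    -- Parity acts through `T` as `(a, b) ↦ (a, -b)`, so its eigenspaces are `b = 0` and `a = 0`.
    rcases zmod_two_eq i with rfl | rfl
    · rw [he, mem_queerGrading_zero, hev, hσT, hTi.eq_iff, Prod.mk_right_injective _ |>.eq_iff]
      exact ⟨fun h' => IsSuperalgebra.eq_zero_of_eq_neg (K := K) h'.symm,
        fun h' => by rw [h', neg_zero]⟩
    · rw [he, mem_queerGrading_one, hod, hσT, ← map_neg, hTi.eq_iff, Prod.neg_mk, Prod.mk.injEq]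
      exact ⟨fun h' => IsSuperalgebra.eq_zero_of_eq_neg (K := K) h'.1,
        fun h' => by simp [h']⟩

theorem IsSimpleSuperalgebra.exists_isOddSymmetric_iff [IsAlgClosed K] [CharZero K]
    (h : IsSimpleSuperalgebra 𝒜) :
    (∃ B : LinearMap.BilinForm K A, IsOddSymmetric 𝒜 B) ↔
      ∃ n : ℕ, 1 ≤ n ∧ Isomorphic 𝒜 (queerGrading K n) := by
  refine ⟨fun ⟨B, hB⟩ => ?_, fun ⟨n, _, he⟩ =>
    IsOddSymmetric.exists_of_isomorphic he isOddSymmetric_queerForm⟩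
  by_cases hs : ∀ I : Submodule K A, IsTwoSidedIdeal I → I = ⊥ ∨ I = ⊤
  · obtain ⟨n, hn, e, he⟩ := exists_matrix_equiv_of_simple h.exists_mul_ne_zero hs
    have : Nonempty (Fin n) := ⟨⟨0, hn⟩⟩
    exact (not_isOddSymmetric_of_matrix h.superalgebra e he hB).elim
  · push Not at hs
    obtain ⟨I, hI, hbot, htop⟩ := hs
    exact h.isomorphic_queer hI hbot htop

end Classification
end Superalg
-- Assembly of the main theorem.
theorem mainTheorem3 (K : Type*) [Field K] [IsAlgClosed K] [CharZero K] :
    -- each `Q_n(K)`, `n ≥ 1`, is simple, and the trace form is, up to a nonzero scalar,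
    -- its only odd-symmetric structure
    (∀ n : ℕ, 1 ≤ n →
      Superalg.IsSimpleSuperalgebra (Superalg.queerGrading K n) ∧
      Superalg.IsOddSymmetric (Superalg.queerGrading K n) (Superalg.queerForm K n) ∧
      (∀ a b : Matrix (Fin n) (Fin n) K,
        Superalg.queerForm K n (Superalg.queerEven a) (Superalg.queerOdd b) =
          (a * b).trace) ∧
      (∀ B : LinearMap.BilinForm K (Superalg.Queer K n),
        Superalg.IsOddSymmetric (Superalg.queerGrading K n) B →
          ∃ c : K, c ≠ 0 ∧ B = c • Superalg.queerForm K n)) ∧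
    -- no `M_{r,s}(K)` has an odd-symmetric structure
    (∀ r s : ℕ, 1 ≤ r →
      Superalg.IsSimpleSuperalgebra (Superalg.matGrading K r s) ∧
      ¬ ∃ B : LinearMap.BilinForm K (Superalg.Mat K r s),
        Superalg.IsOddSymmetric (Superalg.matGrading K r s) B) ∧
    -- classification among all finite dimensional simple associative superalgebras
    (∀ (A : Type*) [NonUnitalRing A] [Module K A] [IsScalarTower K A A]
        [SMulCommClass K A A] [FiniteDimensional K A] (𝒜 : ZMod 2 → Submodule K A),
      Superalg.IsSimpleSuperalgebra 𝒜 →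
      ((∃ B : LinearMap.BilinForm K A, Superalg.IsOddSymmetric 𝒜 B) ↔
        ∃ n : ℕ, 1 ≤ n ∧ Superalg.Isomorphic 𝒜 (Superalg.queerGrading K n)) ∧
      -- the commutative case, and the absence of a supercommutative one
      (((∃ B : LinearMap.BilinForm K A, Superalg.IsOddSymmetric 𝒜 B) ∧
          ∀ x y : A, x * y = y * x) ↔
        Superalg.Isomorphic 𝒜 (Superalg.queerGrading K 1)) ∧
      ((∃ B : LinearMap.BilinForm K A, Superalg.IsOddSymmetric 𝒜 B) →
        ¬ Superalg.IsSupercommutative 𝒜)) := by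
  refine ⟨fun n hn => ⟨Superalg.isSimpleSuperalgebra_queerGrading hn,
      Superalg.isOddSymmetric_queerForm, fun a b => ?_,
      fun B hB => Superalg.exists_eq_smul_queerForm hn hB⟩,
    fun r s hr => ⟨Superalg.isSimpleSuperalgebra_matGrading K r s hr, fun ⟨B, hB⟩ => ?_⟩, ?_⟩
  · rw [Superalg.queerEven_eq, Superalg.queerOdd_eq, Superalg.queerForm_apply]
    simp
  · have : Nonempty (Fin r ⊕ Fin s) := ⟨Sum.inl ⟨0, hr⟩⟩
    exact Superalg.not_isOddSymmetric_of_matrix (Superalg.isSuperalgebra_matGrading K r s)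
      (LinearEquiv.refl K _) (fun _ _ => rfl) hB
  · intro A _ _ _ _ _ 𝒜 h
    have hiff := h.exists_isOddSymmetric_iff
    refine ⟨hiff, ⟨fun ⟨hB, hcomm⟩ => ?_, fun he => ⟨hiff.2 ⟨1, le_rfl, he⟩,
      Superalg.mul_comm_of_isomorphic_queer_one he⟩⟩, fun hB => ?_⟩
    · obtain ⟨n, hn, he⟩ := hiff.1 hB
      obtain rfl := Superalg.eq_one_of_isomorphic_queer hn he hcomm
      exact he
    · obtain ⟨n, hn, he⟩ := hiff.1 hB
      exact Superalg.not_isSupercommutative_of_isomorphic_queer hn he
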